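/- Let $0<\beta<1$ and let $n\ge 1$ be an integer. For real $a,b$ and $m\ge 0$ let $$P_m^{(a,b)}(\tau)=2^{-m}\sum_{k=0}^{m}\binom{m+a}{m-k}\binom{m+b}{k}(\tau-1)^k(\tau+1)^{m-k}$$ be the Jacobi polynomial, let $\hat P_m^{(a,b)}(x)=P_m^{(a,b)}(2x-1)$ be the shifted one, and put $\hat P_{-1}^{(a,b)}=0$. Let $\xi_1,\dots,\xi_n$ be the $n$ zeros of $P_n^{(1,1)}$ (the Jacobi--Gauss nodes with parameters $(1,1)$), and let $\omega_1,\dots,\omega_n$ be the corresponding Jacobi--Gauss quadrature weights on $[-1,1]$, $$\omega_j=\int_{-1}^1(1-t^2)\prod_{k\ne j}\frac{t-\xi_k}{\xi_j-\xi_k}\,dt .$$ Put $\hat\xi_i=\tfrac12(\xi_i+1)$ and $$\mathring\ell_j(x)=\frac{x(1-x)}{\hat\xi_j(1-\hat\xi_j)}\prod_{k\neq j}\frac{x-\hat\xi_k}{\hat\xi_j-\hat\xi_k},\qquad j=1,\dots,n .$$ For $\alpha\in(1,2)$ let $${}_0\mathcal D_x^{\alpha}g(x)=\frac1{\Gamma(2-\alpha)}\frac{d^2}{dx^2}\int_0^x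 (x-s)^{1-\alpha}g(s)\,ds$$ be the left Riemann--Liouville derivative. For $1\le j,k\le n$ set $$\lambda_{jk}=\frac{(2k+1)(k+1)}{8k}\,\frac{\omega_j}{\hat\xi_j(1-\hat\xi_j)}\,\hat P_{k-1}^{(1,1)}(\hat\xi_j),$$ and for $1\le k\le n$ and $x>0$ set $$\zeta_k(x)=\frac{\Gamma(k+1)}{\Gamma(k-1+\beta)}x^{\beta-1}\hat P_{k-1}^{(3-\beta,\beta-1)}(x) -\frac{\Gamma(k+2)}{\Gamma(k+\beta)}\frac{k+2}{2k+1}x^{\beta}\hat P_{k-1}^{(3-\beta,\beta)}(x) -\frac{\Gamma(k+1)}{\Gamma(k-1+\beta)}\frac{k}{2k+1}x^{\beta}\hat P_{k-2}^{(3-\beta,\beta)}(x).$$ Then the $\lambda_{jk}$ are the coefficients of $\mathring\ell_j$ in the expansion $$\mathring\ell_j(x)=\sum_{k=1}^n\lambda_{jk}\,x(1-x)\hat P_{k-1}^{(1,1)}(x)\qquad(x\in\mathbb R,\ 1\le j\le n),$$ and for all $1\le i,j\le n$ the derivative ${}_0\mathcal D_x^{2-\beta}\mathring\ell_j(\hat\xi_i)$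 exists, and the $(i,j)$ entry of the left fractional differentiation matrix is $$d_{ij}^+:={}_0\mathcal D_x^{2-\beta}\mathring\ell_j(\hat\xi_i)=\sum_{k=1}^n\lambda_{jk}\,\zeta_k(\hat\xi_i).$$ -/

import Mathlib

open scoped Topology

noncomputable section

namespace FracDiff

/-- The Jacobi polynomial of degree `n` with real parameters `a`, `b`:
`2⁻ⁿ ∑ₖ (n+a choose n-k) (n+b choose k) (τ-1)ᵏ (τ+1)ⁿ⁻ᵏ`, with generalized binomial coefficients
(`Ring.choose r k = r (r-1) ⋯ (r-k+1) / k!`). -/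
def jacobi (a b : ℝ) (n : ℕ) : Polynomial ℝ :=
  Polynomial.C (1 / 2 ^ n : ℝ) * ∑ k ∈ Finset.range (n + 1),
    Polynomial.C (Ring.choose ((n : ℝ) + a) (n - k) * Ring.choose ((n : ℝ) + b) k) *
      (Polynomial.X - 1) ^ k * (Polynomial.X + 1) ^ (n - k)

/-- The shifted Jacobi polynomial, `x ↦ P_n^{(a,b)}(2x-1)`. -/
def shiftedJacobi (a b : ℝ) (n : ℕ) (x : ℝ) : ℝ :=
  (jacobi a b n).eval (2 * x - 1)

/-- `ξ` enumerates, without repetition and in any order, the zeros of `P_n^{(a,b)}`, i.e. the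
`n` Jacobi–Gauss nodes with parameters `a`, `b`. -/
def IsJacobiGaussNodes (a b : ℝ) (n : ℕ) (ξ : Fin n → ℝ) : Prop :=
  Function.Injective ξ ∧ Set.range ξ = {t : ℝ | (jacobi a b n).eval t = 0}

/-- The weight at the node `ξ j` of the interpolatory quadrature rule on `[-1,1]` with nodes `ξ`
and weight function `(1-t)^a (1+t)^b`; for the Jacobi–Gauss nodes it is the Jacobi–Gauss
weight. -/
def gaussWeight (a b : ℝ) {n : ℕ} (ξ : Fin n → ℝ) (j : Fin n) : ℝ :=
  ∫ t in (-1 : ℝ)..1, (1 - t) ^ a * (1 + t) ^ b * (Lagrange.basis Finset.univ ξ j).eval t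

/-- The nodes transported from `[-1,1]` to `[0,1]`. -/
def shiftedNode {n : ℕ} (ξ : Fin n → ℝ) (i : Fin n) : ℝ :=
  (ξ i + 1) / 2

/-- The Lagrange basis polynomial of the shifted nodes, modified by the factor
`x(1-x) / (ξ̂_j (1-ξ̂_j))` so as to vanish at `0` and `1`. -/
def modLagrange {n : ℕ} (ξ : Fin n → ℝ) (j : Fin n) (x : ℝ) : ℝ :=
  x * (1 - x) / (shiftedNode ξ j * (1 - shiftedNode ξ j)) *
    (Lagrange.basis Finset.univ (shiftedNode ξ) j).eval x

/-- `y ↦ ∫₀^y (y-s)^(1-α) g(s) ds`. -/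
def rlIntegral (α : ℝ) (g : ℝ → ℝ) (y : ℝ) : ℝ :=
  ∫ s in (0 : ℝ)..y, (y - s) ^ (1 - α) * g s

/-- The left Riemann–Liouville derivative on `[0,1]` of order `α ∈ (1,2)`:
`1/Γ(2-α) · d²/dx² ∫₀^x (x-s)^(1-α) g(s) ds`. -/
def leftRLDeriv (α : ℝ) (g : ℝ → ℝ) (x : ℝ) : ℝ :=
  1 / Real.Gamma (2 - α) * deriv (deriv (rlIntegral α g)) x

/-- The left Riemann–Liouville derivative of order `α` exists at `x`: near `x` the defining
integral converges and is differentiable, and its derivative is differentiable at `x`. -/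
def LeftRLDifferentiableAt (α : ℝ) (g : ℝ → ℝ) (x : ℝ) : Prop :=
  (∀ᶠ y in 𝓝 x, IntervalIntegrable (fun s => (y - s) ^ (1 - α) * g s) MeasureTheory.volume 0 y) ∧
  (∀ᶠ y in 𝓝 x, DifferentiableAt ℝ (rlIntegral α g) y) ∧
  DifferentiableAt ℝ (deriv (rlIntegral α g)) x

/-- The left fractional differentiation matrix of order `2-β`. -/
def leftFracDiffMatrix (β : ℝ) {n : ℕ} (ξ : Fin n → ℝ) : Matrix (Fin n) (Fin n) ℝ :=
  Matrix.of fun i j => leftRLDeriv (2 - β) (modLagrange ξ j) (shiftedNode ξ i)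

/-- The coefficient `λ_{jk}`, `k ≥ 1`, where the weights `gaussWeight 1 1 ξ j` refer to the
interval `[-1,1]`. -/
def lam {n : ℕ} (ξ : Fin n → ℝ) (j : Fin n) (k : ℕ) : ℝ :=
  ((2 * k + 1) * (k + 1) / (8 * k) : ℝ) *
    (gaussWeight 1 1 ξ j / (shiftedNode ξ j * (1 - shiftedNode ξ j))) *
    shiftedJacobi 1 1 (k - 1) (shiftedNode ξ j)

/-- The function `ζ_k`, `k ≥ 1`; the polynomial of degree `k-2` is zero for `k = 1`. -/
def zeta (β : ℝ) (k : ℕ) (x : ℝ) : ℝ :=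
  Real.Gamma (k + 1) / Real.Gamma (k - 1 + β) * x ^ (β - 1) *
      shiftedJacobi (3 - β) (β - 1) (k - 1) x
    - Real.Gamma (k + 2) / Real.Gamma (k + β) * ((k + 2) / (2 * k + 1)) * x ^ β *
      shiftedJacobi (3 - β) β (k - 1) x
    - Real.Gamma (k + 1) / Real.Gamma (k - 1 + β) * (k / (2 * k + 1)) * x ^ β *
      (if k = 1 then 0 else shiftedJacobi (3 - β) β (k - 2) x)

end FracDiff

end

noncomputable section

namespace FracDiff

open Polynomial Finset

/-! Two independent facts are combined. The first is algebraic: the Lagrange basis polynomial at the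
Gauss nodes has degree below `n`, so it equals its Fourier–Jacobi sum for the weight `x(1-x)`. Gauss
quadrature turns each Fourier coefficient into a weight times a value at the node
(`basis_eq_sum_shiftedJacobiPoly`), and multiplying by `x(1-x)/(ξ̂_j(1-ξ̂_j))` gives the `λ_{jk}`.

The second is fractional calculus. For `x > 0` the Riemann–Liouville derivative of a polynomial is
computed monomial by monomial from Euler's beta integral (`leftRL_eval`). In the monomial basis a
shifted Jacobi polynomial has binomial coefficients, and the resulting Gamma quotients only shift
its parameters (`rlPoly_X_pow_mul_shiftedJacobiPoly`). A contiguity relation then yields `zeta` as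
the derivative of `x(1-x)P̂_{k-1}^{(1,1)}`. Linearity finishes, as the nodes lie inside `(0,1)`. -/

/-! ### Shifted Jacobi polynomials in the monomial basis. -/

/-- The shifted Jacobi polynomial as a polynomial. -/
def shiftedJacobiPoly (a b : ℝ) (m : ℕ) : ℝ[X] :=
  (jacobi a b m).comp (C 2 * X - 1)

theorem eval_shiftedJacobiPoly (a b : ℝ) (m : ℕ) (x : ℝ) :
    (shiftedJacobiPoly a b m).eval x = shiftedJacobi a b m x := by
  simp [shiftedJacobiPoly, shiftedJacobi]

theorem shiftedJacobiPoly_eq_sum (a b : ℝ) (m : ℕ) :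
    shiftedJacobiPoly a b m = ∑ k ∈ range (m + 1),
      C (Ring.choose ((m : ℝ) + a) (m - k) * Ring.choose ((m : ℝ) + b) k) *
        (X - 1) ^ k * X ^ (m - k) := by
  rw [shiftedJacobiPoly, jacobi, mul_comp, C_comp, Polynomial.sum_comp, mul_sum]
  refine sum_congr rfl fun k hk => ?_
  have hk' : k ≤ m := Nat.lt_succ_iff.mp (mem_range.mp hk)
  have h1 : (C 2 * X - 1 - 1 : ℝ[X]) = C 2 * (X - 1) := by
    have : (C 2 : ℝ[X]) = 2 := rfl
    rw [this]; ring
  have h2 : (C 2 * X - 1 + 1 : ℝ[X]) = C 2 * X := by ring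
  simp only [mul_comp, C_comp, pow_comp, sub_comp, add_comp, X_comp, one_comp, h1, h2, mul_pow]
  have h3 : (C (1 / 2 ^ m : ℝ) : ℝ[X]) * (C 2 ^ k * C 2 ^ (m - k)) = 1 := by
    rw [← pow_add, Nat.add_sub_cancel' hk', ← C_pow, ← C_mul]
    simp
  calc _ = (C (1 / 2 ^ m : ℝ) * (C 2 ^ k * C 2 ^ (m - k))) *
        (C (Ring.choose ((m : ℝ) + a) (m - k) * Ring.choose ((m : ℝ) + b) k) *
        (X - 1) ^ k * X ^ (m - k)) := by ring
    _ = _ := by rw [h3, one_mul]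

theorem natDegree_shiftedJacobiPoly_le (a b : ℝ) (m : ℕ) :
    (shiftedJacobiPoly a b m).natDegree ≤ m := by
  rw [shiftedJacobiPoly_eq_sum]
  refine natDegree_sum_le_of_forall_le _ _ fun k hk => ?_
  have hk' : k ≤ m := Nat.lt_succ_iff.mp (mem_range.mp hk)
  have : ((X : ℝ[X]) - 1).natDegree ≤ 1 := by
    rw [← C_1]; exact natDegree_X_sub_C_le _
  calc _ ≤ (0 + k * 1) + (m - k) := by
        refine natDegree_mul_le_of_le (natDegree_mul_le_of_le (natDegree_C _).le
          (natDegree_pow_le_of_le _ this)) (natDegree_X_pow_le _)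
    _ = m := by omega

/-- The coefficients of the shifted Jacobi polynomials, by the Chu–Vandermonde identity. -/
theorem coeff_shiftedJacobiPoly (a b : ℝ) {m j : ℕ} (hj : j ≤ m) :
    (shiftedJacobiPoly a b m).coeff j =
      (-1) ^ (m - j) * Ring.choose ((m : ℝ) + a + b + j) j * Ring.choose ((m : ℝ) + b) (m - j) := by
  have hsplit : (m : ℝ) + a + b + j = (m + a) + (b + j) := by ring
  rw [shiftedJacobiPoly_eq_sum, ← sum_range_reflect, finsetSum_coeff, hsplit,
    Ring.add_choose_eq j (Commute.all _ _), Nat.sum_antidiagonal_eq_sum_range_succ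
      (fun p q => Ring.choose ((m : ℝ) + a) p * Ring.choose (b + j) q), mul_sum, sum_mul]
  -- The term with factor `X ^ l` contributes to the coefficient of `X ^ j` only if `l ≤ j`, which
  -- is exactly the range of the Vandermonde sum.
  rw [← sum_subset (range_subset_range.mpr (Nat.succ_le_succ hj))]
  · refine sum_congr rfl fun l hl => ?_
    have hl' : l ≤ j := Nat.lt_succ_iff.mp (mem_range.mp hl)
    obtain ⟨d, rfl⟩ := Nat.exists_eq_add_of_le hj
    obtain ⟨i, rfl⟩ := Nat.exists_eq_add_of_le hl'
    have e1 : l + i + d + 1 - 1 - l = d + i := by omega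
    have e2 : l + i + d - (d + i) = l := by omega
    have e3 : l + i - l = i := by omega
    have e4 : l + i + d - (l + i) = d := by omega
    have e5 : d + i - i = d := by omega
    have hv := Ring.choose_smul_choose (((l + i + d : ℕ) : ℝ) + b) (n := d + i) (k := d) (by omega)
    have e6 : ((l + i + d : ℕ) : ℝ) + b - d = b + ((l + i : ℕ) : ℝ) := by push_cast; ring
    rw [e6, Nat.add_sub_cancel_left, nsmul_eq_mul, Nat.choose_symm_add] at hv
    rw [e1, e2, coeff_mul_X_pow', if_pos (Nat.le_add_right l i), coeff_C_mul, ← C_1,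
      sub_eq_add_neg, ← C_neg, coeff_X_add_C_pow, e3, e4, e5]
    linear_combination (Ring.choose (((l + i + d : ℕ) : ℝ) + a) l * (-1) ^ d) * hv
  · intro l hl hl'
    have h1 : l ≤ m := Nat.lt_succ_iff.mp (mem_range.mp hl)
    have h2 : ¬ l ≤ j := fun h => hl' (mem_range.mpr (Nat.lt_succ_of_le h))
    rw [coeff_mul_X_pow', if_neg]
    omega

theorem shiftedJacobiPoly_eq_sum_coeff (a b : ℝ) (m : ℕ) :
    shiftedJacobiPoly a b m = ∑ j ∈ range (m + 1),
      ((-1) ^ (m - j) * Ring.choose ((m : ℝ) + a + b + j) j *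
        Ring.choose ((m : ℝ) + b) (m - j)) • X ^ j := by
  conv_lhs => rw [(shiftedJacobiPoly a b m).as_sum_range' (m + 1)
    (Nat.lt_succ_of_le (natDegree_shiftedJacobiPoly_le a b m))]
  refine sum_congr rfl fun j hj => ?_
  rw [coeff_shiftedJacobiPoly a b (Nat.lt_succ_iff.mp (mem_range.mp hj)), ← smul_X_eq_monomial]

/-! ### Fractional derivatives of Jacobi polynomials, formally. -/

theorem choose_eq_Gamma_div (r : ℝ) (i : ℕ) (h : 0 < r - i + 1) :
    Ring.choose r i = Real.Gamma (r + 1) / (Real.Gamma (r - i + 1) * i.factorial) := by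
  induction i with
  | zero =>
    have : 0 < r + 1 := by simpa using h
    simp [(Real.Gamma_pos_of_pos this).ne']
  | succ i ih =>
    push_cast at h
    have h1 : 0 < r - i := by linarith
    have hs := Ring.choose_smul_choose r (n := i + 1) (k := i) (by omega)
    rw [Nat.add_sub_cancel_left, Ring.choose_one_right, ih (by linarith), nsmul_eq_mul,
      Nat.choose_succ_self_right, Real.Gamma_add_one h1.ne'] at hs
    have hG := (Real.Gamma_pos_of_pos h1).ne'
    have e : r - ((i + 1 : ℕ) : ℝ) + 1 = r - i := by push_cast; ring
    have hf : (i.factorial : ℝ) ≠ 0 := by positivity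
    have hi : ((i : ℝ) + 1) ≠ 0 := by positivity
    rw [e, Nat.factorial_succ]
    push_cast at hs ⊢
    field_simp at hs ⊢
    linarith

/-- The linear map sending `X ^ p` to the value at `x` of its Riemann–Liouville derivative of
order `2 - β`. -/
def rlPoly (β x : ℝ) : ℝ[X] →ₗ[ℝ] ℝ :=
  Polynomial.lsum fun p => LinearMap.toSpanSingleton ℝ ℝ
    (Real.Gamma (p + 1) / Real.Gamma (p - 1 + β) * x ^ ((p : ℝ) - 1 + (β - 1)))

theorem rlPoly_X_pow (β x : ℝ) (p : ℕ) :
    rlPoly β x (X ^ p) =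
      Real.Gamma (p + 1) / Real.Gamma (p - 1 + β) * x ^ ((p : ℝ) - 1 + (β - 1)) := by
  simp [rlPoly, Polynomial.lsum_apply, ← monomial_one_right_eq_X_pow, sum_monomial_index]

/-- The sum of the two parameters is preserved, so the first binomial in the `j`-th coefficient does
not change. The Gamma quotient of `X ^ (b + j)` turns `choose (m+b) (m-j)` into `choose (m+b-2+β)
(m-j)`, up to a factor independent of `j`. The condition `1 ≤ b` keeps all Gamma arguments positive.
-/
theorem rlPoly_X_pow_mul_shiftedJacobiPoly {β x : ℝ} (hβ : 0 < β) (hx : 0 < x) (a : ℝ) (b m : ℕ)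
    (hb : 1 ≤ b) :
    rlPoly β x (X ^ b * shiftedJacobiPoly a b m) =
      Real.Gamma (m + b + 1) / Real.Gamma (m + b - 1 + β) * x ^ ((b : ℝ) - 1 + (β - 1)) *
        shiftedJacobi (a + 2 - β) (b - 2 + β) m x := by
  have hb' : (1 : ℝ) ≤ b := by exact_mod_cast hb
  rw [← eval_shiftedJacobiPoly, shiftedJacobiPoly_eq_sum_coeff, shiftedJacobiPoly_eq_sum_coeff,
    mul_sum, map_sum, eval_finsetSum, mul_sum]
  refine sum_congr rfl fun j hj => ?_
  obtain ⟨i, rfl⟩ := Nat.exists_eq_add_of_le (Nat.lt_succ_iff.mp (mem_range.mp hj))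
  rw [mul_smul_comm, ← pow_add, map_smul, rlPoly_X_pow, eval_smul, eval_pow, eval_X,
    Nat.add_sub_cancel_left]
  have hj0 : (0 : ℝ) ≤ j := Nat.cast_nonneg j
  have e1 : ((j + i : ℕ) : ℝ) + b - i + 1 = ((b + j : ℕ) : ℝ) + 1 := by push_cast; ring
  have e2 : ((j + i : ℕ) : ℝ) + (b - 2 + β) - i + 1 = ((b + j : ℕ) : ℝ) - 1 + β := by
    push_cast; ring
  have e3 : ((j + i : ℕ) : ℝ) + (b - 2 + β) + 1 = ((j + i : ℕ) : ℝ) + b - 1 + β := by ring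
  have e4 : ((j + i : ℕ) : ℝ) + (a + 2 - β) + (b - 2 + β) + j = ((j + i : ℕ) : ℝ) + a + b + j := by
    ring
  have p1 : 0 < ((b + j : ℕ) : ℝ) + 1 := by positivity
  have p2 : 0 < ((b + j : ℕ) : ℝ) - 1 + β := by push_cast; linarith
  have p3 : 0 < ((j + i : ℕ) : ℝ) + b - 1 + β := by push_cast; linarith
  have p4 : 0 < ((j + i : ℕ) : ℝ) + b + 1 := by positivity
  have hr : x ^ (((b + j : ℕ) : ℝ) - 1 + (β - 1)) = x ^ ((b : ℝ) - 1 + (β - 1)) * x ^ j := by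
    rw [← Real.rpow_natCast x j, ← Real.rpow_add hx]
    congr 1; push_cast; ring
  rw [choose_eq_Gamma_div _ i (e1 ▸ p1), choose_eq_Gamma_div _ i (e2 ▸ p2), e1, e2, e3, e4, hr]
  have := (Real.Gamma_pos_of_pos p1).ne'
  have := (Real.Gamma_pos_of_pos p2).ne'
  have := (Real.Gamma_pos_of_pos p3).ne'
  have := (Real.Gamma_pos_of_pos p4).ne'
  have hf : (i.factorial : ℝ) ≠ 0 := by positivity
  simp only [smul_eq_mul]
  field_simp

theorem cast_choose_eq (r k : ℕ) (s : ℝ) (h : s = r) : Ring.choose s k = (r.choose k : ℝ) := by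
  rw [h, Ring.choose_natCast]

/-- The contiguity relation lowering the second parameter from `2` to `1`. -/
theorem shiftedJacobiPoly_one_two_contiguous (m : ℕ) :
    (2 * (m + 1 : ℕ) + 3 : ℝ) • shiftedJacobiPoly 1 1 (m + 1) =
      ((m + 1 : ℕ) + 3 : ℝ) • shiftedJacobiPoly 1 2 (m + 1) +
        ((m + 1 : ℕ) + 1 : ℝ) • shiftedJacobiPoly 1 2 m := by
  ext j
  simp only [coeff_add, coeff_smul, smul_eq_mul]
  rcases lt_or_ge (m + 1) j with hj | hj
  · rw [coeff_eq_zero_of_natDegree_lt ((natDegree_shiftedJacobiPoly_le _ _ _).trans_lt hj),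
      coeff_eq_zero_of_natDegree_lt ((natDegree_shiftedJacobiPoly_le _ _ _).trans_lt hj),
      coeff_eq_zero_of_natDegree_lt ((natDegree_shiftedJacobiPoly_le _ _ _).trans_lt
        (m.lt_succ_self.trans hj))]
    ring
  · rw [coeff_shiftedJacobiPoly _ _ hj, coeff_shiftedJacobiPoly _ _ hj]
    -- The top coefficient is separate: the polynomial of degree `m` contributes nothing there.
    rcases hj.eq_or_lt with rfl | hj'
    · rw [coeff_eq_zero_of_natDegree_lt ((natDegree_shiftedJacobiPoly_le _ _ _).trans_lt
        m.lt_succ_self), Nat.sub_self]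
      simp only [pow_zero, Ring.choose_zero_right, mul_one, one_mul, mul_zero, add_zero]
      rw [cast_choose_eq (2 * m + 4) (m + 1) _ (by push_cast; ring),
        cast_choose_eq (2 * m + 5) (m + 1) _ (by push_cast; ring)]
      have h2 := Nat.choose_mul_succ_eq (2 * m + 4) (m + 1)
      have e : 2 * m + 4 + 1 - (m + 1) = m + 4 := by omega
      rw [e] at h2
      have h3 : (((2 * m + 4).choose (m + 1) : ℕ) : ℝ) * (2 * m + 5) =
        ((2 * m + 5).choose (m + 1) : ℕ) * (m + 4) := by exact_mod_cast h2
      push_cast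
      linear_combination h3
    · obtain ⟨i, rfl⟩ := Nat.exists_eq_add_of_le (Nat.lt_succ_iff.mp hj')
      rw [coeff_shiftedJacobiPoly _ _ (Nat.le_add_right j i)]
      have e0 : j + i + 1 - j = i + 1 := by omega
      rw [e0, Nat.add_sub_cancel_left]
      rw [cast_choose_eq (j + (j + i + 3)) j _ (by push_cast; ring),
        cast_choose_eq (j + (j + i + 4)) j _ (by push_cast; ring),
        cast_choose_eq (j + (j + i + 3)) j _ (by push_cast; ring),
        cast_choose_eq ((i + 1) + (j + 1)) (i + 1) _ (by push_cast; ring),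
        cast_choose_eq ((i + 1) + (j + 2)) (i + 1) _ (by push_cast; ring),
        cast_choose_eq (i + (j + 2)) i _ (by push_cast; ring)]
      simp only [Nat.cast_add_choose]
      have f1 : j + (j + i + 4) = (j + (j + i + 3)) + 1 := by ring
      have f2 : i + 1 + (j + 2) = (i + (j + 2)) + 1 := by ring
      have f3 : i + 1 + (j + 1) = i + (j + 2) := by ring
      rw [f1, f2, f3]
      simp only [Nat.factorial_succ]
      push_cast
      have := Nat.cast_ne_zero (R := ℝ).mpr (Nat.factorial_ne_zero j)
      have := Nat.cast_ne_zero (R := ℝ).mpr (Nat.factorial_ne_zero i)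
      have := Nat.cast_ne_zero (R := ℝ).mpr (Nat.factorial_ne_zero (j + i))
      field_simp
      ring

theorem shiftedJacobiPoly_zero (a b : ℝ) : shiftedJacobiPoly a b 0 = 1 := by
  rw [shiftedJacobiPoly_eq_sum]; simp

/-- In `x - x²` the power of `x` must match the second parameter. The `x` part already does; for the
`x²` part the contiguity relation rewrites `P̂^{(1,1)}` through `P̂^{(1,2)}`, which produces the
last two terms of `zeta`. -/
theorem rlPoly_X_mul_one_sub_X_mul {β x : ℝ} (hβ : 0 < β) (hx : 0 < x) (k : ℕ) (hk : 1 ≤ k) :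
    rlPoly β x (X * (1 - X) * shiftedJacobiPoly 1 1 (k - 1)) = zeta β k x := by
  have h1 (m : ℕ) := rlPoly_X_pow_mul_shiftedJacobiPoly hβ hx 1 1 m le_rfl
  have h2 (m : ℕ) := rlPoly_X_pow_mul_shiftedJacobiPoly hβ hx 1 2 m one_le_two
  have a1 : (1 : ℝ) + 2 - β = 3 - β := by ring
  have a2 : (1 : ℝ) - 2 + β = β - 1 := by ring
  have a3 : (2 : ℝ) - 2 + β = β := by ring
  have a4 : (2 : ℝ) - 1 + (β - 1) = β := by ring
  have a5 : (1 : ℝ) - 1 + (β - 1) = β - 1 := by ring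
  simp only [Nat.cast_one, Nat.cast_ofNat, a1, a2, a3, a4, a5, pow_one] at h1 h2
  have hsplit (m : ℕ) : (X * (1 - X) * shiftedJacobiPoly 1 1 m : ℝ[X]) =
      X * shiftedJacobiPoly 1 1 m - X ^ 2 * shiftedJacobiPoly 1 1 m := by ring
  obtain ⟨m, rfl⟩ := Nat.exists_eq_add_of_le' hk
  rw [Nat.add_sub_cancel, hsplit, map_sub, h1, zeta, Nat.add_sub_cancel]
  rcases m with _ | m
  · have h20 := h2 0
    simp only [shiftedJacobiPoly_zero] at h20 ⊢
    rw [h20]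
    norm_num
  · have hc := congrArg (fun P => rlPoly β x (X ^ 2 * P)) (shiftedJacobiPoly_one_two_contiguous m)
    simp only [mul_add, mul_smul_comm, map_add, map_smul, h2, smul_eq_mul] at hc
    have hne : (2 * ((m + 1 : ℕ) : ℝ) + 3) ≠ 0 := by positivity
    rw [if_neg (by omega), show m + 1 + 1 - 2 = m by omega]
    have hc' := (eq_div_iff hne).mpr ((mul_comm _ _).trans hc)
    rw [hc']
    push_cast
    have c1 : (m : ℝ) + 1 + 1 - 1 + β = m + 2 - 1 + β := by ring
    have c2 : (m : ℝ) + 1 + 1 + β = m + 1 + 2 - 1 + β := by ring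
    have c3 : (m : ℝ) + 1 + 1 + 1 = m + 2 + 1 := by ring
    have c4 : (m : ℝ) + 1 + 2 + 1 = m + 1 + 1 + 2 := by ring
    have c5 : 2 * ((m : ℝ) + 1 + 1) + 1 = 2 * (m + 1) + 3 := by ring
    have c6 : (m : ℝ) + 1 + 3 = m + 1 + 1 + 2 := by ring
    rw [c1, c2, c3, c4, c5, c6]
    push_cast at hne
    field_simp
    ring

/-! ### The analytic Riemann–Liouville derivative of a polynomial. -/

theorem intervalIntegrable_sub_rpow_mul {β : ℝ} (hβ : 0 < β) (y : ℝ) {f : ℝ → ℝ}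
    (hf : Continuous f) :
    IntervalIntegrable (fun s => (y - s) ^ (β - 1) * f s) MeasureTheory.volume 0 y := by
  refine IntervalIntegrable.mul_continuousOn ?_ hf.continuousOn
  have h := (intervalIntegral.intervalIntegrable_rpow' (a := y) (b := 0)
    (show -1 < β - 1 by linarith)).comp_sub_left y
  simpa using h

theorem integral_sub_rpow_mul_pow {β : ℝ} (hβ : 0 < β) {y : ℝ} (hy : 0 < y) (p : ℕ) :
    ∫ s in (0 : ℝ)..y, (y - s) ^ (β - 1) * s ^ p =
      Real.Gamma β * (Real.Gamma (p + 1) / Real.Gamma (p + (β + 1)) * y ^ (p + (β + 1) - 1)) := by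
  have h := Complex.betaIntegral_scaled ((p : ℂ) + 1) β hy
  rw [Complex.betaIntegral_eq_Gamma_mul_div _ _ (by simp; positivity) (by simpa)] at h
  rw [← Complex.ofReal_inj, ← intervalIntegral.integral_ofReal]
  have hl : ∫ s in (0 : ℝ)..y, (((y - s) ^ (β - 1) * s ^ p : ℝ) : ℂ) =
      ∫ x in (0 : ℝ)..y, (x : ℂ) ^ ((p : ℂ) + 1 - 1) * ((y : ℂ) - x) ^ ((β : ℂ) - 1) := by
    refine intervalIntegral.integral_congr fun s hs => ?_
    rw [Set.uIcc_of_le hy.le] at hs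
    rw [add_sub_cancel_right, Complex.cpow_natCast]
    push_cast [Complex.ofReal_cpow (sub_nonneg.mpr hs.2)]
    ring
  rw [hl, h]
  have e1 : (p : ℂ) + 1 + β - 1 = ((p + (β + 1) - 1 : ℝ) : ℂ) := by push_cast; ring
  have e2 : (p : ℂ) + 1 + β = ((p + (β + 1) : ℝ) : ℂ) := by push_cast; ring
  have e3 : (p : ℂ) + 1 = ((p + 1 : ℝ) : ℂ) := by push_cast; ring
  rw [e1, e2, e3, Complex.Gamma_ofReal, Complex.Gamma_ofReal, Complex.Gamma_ofReal,
    ← Complex.ofReal_cpow hy.le]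
  push_cast
  ring

/-- The linear combination of real powers obtained from the polynomial `P` by replacing `X ^ p`
with `Γ(p+1) / Γ(p+γ) y^(p+γ-1)`, the fractional derivative of order `1 - γ`. -/
def powerShift (γ : ℝ) (P : ℝ[X]) (y : ℝ) : ℝ :=
  ∑ p ∈ range (P.natDegree + 1),
    P.coeff p * (Real.Gamma (p + 1) / Real.Gamma (p + γ) * y ^ (p + γ - 1))

/-- The exponent brought down by differentiation is absorbed by `Γ(z+1) = zΓ(z)`, so each derivative
lowers `γ` by one. -/
theorem hasDerivAt_powerShift {γ : ℝ} (hγ : ∀ p : ℕ, (p : ℝ) + γ ≠ 0) (P : ℝ[X]) {y : ℝ}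
    (hy : 0 < y) : HasDerivAt (powerShift (γ + 1) P) (powerShift γ P y) y := by
  unfold powerShift
  refine HasDerivAt.fun_sum fun p _ => ?_
  have h := ((Real.hasDerivAt_rpow_const (p := p + (γ + 1) - 1) (Or.inl hy.ne')).const_mul
    (Real.Gamma (p + 1) / Real.Gamma (p + (γ + 1)))).const_mul (P.coeff p)
  refine h.congr_deriv ?_
  have e1 : (p : ℝ) + (γ + 1) - 1 = p + γ := by ring
  have e2 : (p : ℝ) + (γ + 1) = p + γ + 1 := by ring
  rw [e1, e2, Real.Gamma_add_one (hγ p)]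
  have := hγ p
  rw [div_mul_eq_mul_div, div_mul_eq_mul_div, mul_left_comm (Real.Gamma _) _ _,
    mul_div_mul_left _ _ this]

theorem rlIntegral_eval {β : ℝ} (hβ : 0 < β) (P : ℝ[X]) {y : ℝ} (hy : 0 < y) :
    rlIntegral (2 - β) (fun s => P.eval s) y = Real.Gamma β * powerShift (β + 1) P y := by
  have e : 1 - (2 - β) = β - 1 := by ring
  simp only [rlIntegral, powerShift, e, eval_eq_sum_range, mul_sum]
  rw [intervalIntegral.integral_finsetSum]
  · refine sum_congr rfl fun p _ => ?_
    simp only [mul_left_comm _ (P.coeff p)]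
    rw [intervalIntegral.integral_const_mul, integral_sub_rpow_mul_pow hβ hy]
  · intro p _
    exact intervalIntegrable_sub_rpow_mul hβ y (by fun_prop)

theorem powerShift_eq_rlPoly (β : ℝ) (P : ℝ[X]) (x : ℝ) :
    powerShift (β - 1) P x = rlPoly β x P := by
  conv_rhs => rw [P.as_sum_range_C_mul_X_pow]
  simp only [map_sum, powerShift, ← smul_eq_C_mul, map_smul, rlPoly_X_pow, smul_eq_mul]
  refine sum_congr rfl fun p _ => ?_
  congr 4 <;> ring

theorem leftRL_eval {β : ℝ} (hβ0 : 0 < β) (hβ1 : β < 1) (P : ℝ[X]) {x : ℝ} (hx : 0 < x) :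
    LeftRLDifferentiableAt (2 - β) (fun s => P.eval s) x ∧
      leftRLDeriv (2 - β) (fun s => P.eval s) x = rlPoly β x P := by
  have hβ : ∀ p : ℕ, (p : ℝ) + β ≠ 0 := fun p => by positivity
  -- Only `p = 0` needs `β < 1`.
  have hβ' : ∀ p : ℕ, (p : ℝ) + (β - 1) ≠ 0 := by
    rintro (_ | p)
    · norm_num; linarith
    · push_cast; have : (0 : ℝ) ≤ p := p.cast_nonneg; intro h; linarith
  have h1 : ∀ y : ℝ, 0 < y → HasDerivAt (rlIntegral (2 - β) fun s => P.eval s)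
      (Real.Gamma β * powerShift β P y) y := fun y hy =>
    ((hasDerivAt_powerShift hβ P hy).const_mul _).congr_of_eventuallyEq <|
      (eventually_gt_nhds hy).mono fun z hz => rlIntegral_eval hβ0 P hz
  have h2 : HasDerivAt (deriv (rlIntegral (2 - β) fun s => P.eval s))
      (Real.Gamma β * powerShift (β - 1) P x) x := by
    have := (hasDerivAt_powerShift hβ' P hx).const_mul (Real.Gamma β)
    rw [sub_add_cancel] at this
    exact this.congr_of_eventuallyEq ((eventually_gt_nhds hx).mono fun z hz => (h1 z hz).deriv)
  refine ⟨⟨.of_forall fun y => ?_, (eventually_gt_nhds hx).mono fun y hy =>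
    (h1 y hy).differentiableAt, h2.differentiableAt⟩, ?_⟩
  · have e : 1 - (2 - β) = β - 1 := by ring
    rw [e]
    exact intervalIntegrable_sub_rpow_mul hβ0 y P.continuous
  · rw [leftRLDeriv, h2.deriv, powerShift_eq_rlPoly, sub_sub_cancel, one_div,
      inv_mul_cancel_left₀ (Real.Gamma_pos_of_pos hβ0).ne']

/-! ### Rodrigues' formula, orthogonality and norms for the weight `x(1-x)`. -/

/-- Integration of polynomials over `[0,1]`. -/
def unitIntegral : ℝ[X] →ₗ[ℝ] ℝ where
  toFun P := ∫ x in (0 : ℝ)..1, P.eval x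
  map_add' P Q := by
    simp only [eval_add]
    exact intervalIntegral.integral_add (P.continuous.intervalIntegrable _ _)
      (Q.continuous.intervalIntegrable _ _)
  map_smul' c P := by simp

theorem unitIntegral_apply (P : ℝ[X]) : unitIntegral P = ∫ x in (0 : ℝ)..1, P.eval x := rfl

theorem unitIntegral_derivative (P : ℝ[X]) :
    unitIntegral (derivative P) = P.eval 1 - P.eval 0 :=
  intervalIntegral.integral_eq_sub_of_hasDerivAt (fun x _ => P.hasDerivAt x)
    ((derivative P).continuous.intervalIntegrable _ _)

/-- Repeated integration by parts: before the last derivative a factor `X * (X - 1)` survives, so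
every boundary term vanishes. -/
theorem unitIntegral_iterate_derivative_mul {m : ℕ} {W : ℝ[X]} (hW : (X * (X - 1)) ^ m ∣ W)
    (q : ℝ[X]) :
    unitIntegral (derivative^[m] W * q) = (-1) ^ m * unitIntegral (W * derivative^[m] q) := by
  induction m generalizing q with
  | zero => simp
  | succ m ih =>
    have hb : X * (X - 1) ∣ derivative^[m] W := by
      simpa using pow_sub_dvd_iterate_derivative_of_pow_dvd m hW
    obtain ⟨V, hV⟩ := hb
    have hd := unitIntegral_derivative (derivative^[m] W * q)
    rw [derivative_mul, map_add, ih ((pow_dvd_pow _ m.le_succ).trans hW) (derivative q),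
      ← Function.iterate_succ_apply, ← Function.iterate_succ_apply' (f := derivative), hV] at hd
    simp only [eval_mul, eval_X, eval_sub, eval_one, sub_self, mul_zero, zero_mul] at hd
    rw [pow_succ]
    linear_combination hd

/-- Rodrigues' formula. -/
theorem factorial_smul_mul_shiftedJacobiPoly (m : ℕ) :
    (m.factorial : ℝ) • (X * (X - 1) * shiftedJacobiPoly 1 1 m) =
      derivative^[m] ((X * (X - 1)) ^ (m + 1)) := by
  rw [mul_pow, ← C_1, iterate_derivative_mul, shiftedJacobiPoly_eq_sum, ← sum_range_reflect,
    mul_sum, smul_sum]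
  refine sum_congr rfl fun k hk => ?_
  obtain ⟨i, rfl⟩ := Nat.exists_eq_add_of_le (Nat.lt_succ_iff.mp (mem_range.mp hk))
  have e1 : k + i + 1 - 1 - k = i := by omega
  have e2 : k + i - i = k := by omega
  have e3 : k + i - k = i := by omega
  have e4 : k + i + 1 - i = k + 1 := by omega
  have e5 : k + i + 1 - k = i + 1 := by omega
  rw [e1, e2, e3, iterate_derivative_X_sub_pow, iterate_derivative_X_pow_eq_C_mul, e4, e5,
    cast_choose_eq (k + i + 1) _ _ (by push_cast; ring),
    cast_choose_eq (k + i + 1) _ _ (by push_cast; ring), Nat.descFactorial_eq_factorial_mul_choose,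
    Nat.descFactorial_eq_factorial_mul_choose]
  have hf := Nat.choose_mul_factorial_mul_factorial (Nat.le_add_right k i)
  rw [Nat.add_sub_cancel_left] at hf
  have hf' : (((k + i).choose k : ℕ) : ℝ[X]) * (k.factorial : ℝ[X]) * (i.factorial : ℝ[X]) =
      ((k + i).factorial : ℝ[X]) := by exact_mod_cast congrArg (Nat.cast (R := ℝ[X])) hf
  simp only [nsmul_eq_mul, smul_eq_C_mul, C_mul, map_natCast, Nat.cast_mul, C_1]
  rw [← hf']
  ring

theorem coeff_shiftedJacobiPoly_one_one_self (m : ℕ) :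
    (shiftedJacobiPoly 1 1 m).coeff m = ((2 * m + 2).choose m : ℕ) := by
  rw [coeff_shiftedJacobiPoly _ _ le_rfl, Nat.sub_self, Ring.choose_zero_right, pow_zero, one_mul,
    mul_one, cast_choose_eq (2 * m + 2) m _ (by push_cast; ring)]

theorem factorial_mul_unitIntegral (m : ℕ) (q : ℝ[X]) :
    (m.factorial : ℝ) * unitIntegral (X * (1 - X) * shiftedJacobiPoly 1 1 m * q) =
      (-1) ^ (m + 1) * unitIntegral ((X * (X - 1)) ^ (m + 1) * derivative^[m] q) := by
  have h := unitIntegral_iterate_derivative_mul (pow_dvd_pow (X * (X - 1)) m.le_succ) q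
  rw [← factorial_smul_mul_shiftedJacobiPoly, smul_mul_assoc, map_smul, smul_eq_mul] at h
  have e : (X * (1 - X) * shiftedJacobiPoly 1 1 m * q : ℝ[X]) =
      -(X * (X - 1) * shiftedJacobiPoly 1 1 m * q) := by ring
  rw [e, map_neg, pow_succ]
  linear_combination -h

theorem unitIntegral_shiftedJacobiPoly_mul_eq_zero {m : ℕ} {q : ℝ[X]} (hq : q.natDegree < m) :
    unitIntegral (X * (1 - X) * shiftedJacobiPoly 1 1 m * q) = 0 := by
  have h := factorial_mul_unitIntegral m q
  rw [iterate_derivative_eq_zero hq, mul_zero, map_zero, mul_zero] at h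
  exact (mul_eq_zero.mp h).resolve_left (by positivity)

theorem unitIntegral_X_mul_pow (n : ℕ) :
    unitIntegral ((X * (X - 1)) ^ n) =
      (-1) ^ n * ((n.factorial : ℝ) ^ 2 / (2 * n + 1).factorial) := by
  have h := integral_sub_rpow_mul_pow (β := n + 1) (by positivity) one_pos n
  have e1 : (n : ℝ) + 1 - 1 = n := by ring
  have e2 : (n : ℝ) + (n + 1 + 1) = ((2 * n + 1 : ℕ) : ℝ) + 1 := by push_cast; ring
  rw [e1, e2, Real.Gamma_nat_eq_factorial, Real.Gamma_nat_eq_factorial, Real.one_rpow] at h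
  have e3 : ∀ s : ℝ, ((X * (X - 1)) ^ n : ℝ[X]).eval s = (-1) ^ n * ((1 - s) ^ (n : ℝ) * s ^ n) := by
    intro s
    rw [Real.rpow_natCast, ← mul_pow, ← mul_pow, eval_pow]
    congr 1
    simp only [eval_mul, eval_X, eval_sub, eval_one]
    ring
  rw [unitIntegral_apply]
  simp only [e3]
  rw [intervalIntegral.integral_const_mul, h]
  ring

/-- Rodrigues' formula moves `m` derivatives onto the second factor, leaving `m!` times its leading
coefficient; what remains is a beta integral. -/
theorem unitIntegral_shiftedJacobiPoly_sq (m : ℕ) :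
    unitIntegral (X * (1 - X) * shiftedJacobiPoly 1 1 m * shiftedJacobiPoly 1 1 m) =
      (m + 1) / ((2 * m + 3) * (m + 2)) := by
  have h := factorial_mul_unitIntegral m (shiftedJacobiPoly 1 1 m)
  have hd : derivative^[m] (shiftedJacobiPoly 1 1 m) =
      C ((m.factorial : ℝ) * ((2 * m + 2).choose m : ℕ)) := by
    have h0 : (derivative^[m] (shiftedJacobiPoly 1 1 m)).natDegree ≤ 0 := by
      have := natDegree_iterate_derivative (shiftedJacobiPoly 1 1 m) m
      have := natDegree_shiftedJacobiPoly_le 1 1 m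
      omega
    rw [eq_C_of_natDegree_le_zero h0, coeff_iterate_derivative, zero_add,
      Nat.descFactorial_self, coeff_shiftedJacobiPoly_one_one_self, nsmul_eq_mul]
  have e : 2 * m + 2 = m + (m + 2) := by ring
  have e' : 2 * (m + 1) + 1 = m + (m + 2) + 1 := by ring
  rw [hd, mul_comm _ (C _), ← smul_eq_C_mul, map_smul, smul_eq_mul, unitIntegral_X_mul_pow, e, e',
    Nat.cast_add_choose] at h
  have hs : ((-1 : ℝ) ^ (m + 1)) * (-1) ^ (m + 1) = 1 := by rw [← mul_pow]; simp
  have f1 : (m.factorial : ℝ) ≠ 0 := by positivity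
  have f2 : ((m + (m + 2)).factorial : ℝ) ≠ 0 := by positivity
  simp only [Nat.factorial_succ (m + (m + 2)), Nat.factorial_succ (m + 1),
    Nat.factorial_succ m] at h
  push_cast at h
  refine mul_left_cancel₀ f1 (h.trans ?_)
  have key : ∀ s A B : ℝ, s * s = 1 → s * (A * (s * B)) = A * B := fun s A B hss => by
    linear_combination A * B * hss
  rw [key _ _ _ hs]
  field_simp
  ring

/-- The polynomials of degree less than `n` are spanned by the first `n` Jacobi polynomials. -/
theorem exists_eq_sum_shiftedJacobiPoly (n : ℕ) (p : ℝ[X]) (hp : p.degree < n) :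
    ∃ c : ℕ → ℝ, p = ∑ i ∈ range n, c i • shiftedJacobiPoly 1 1 i := by
  induction n generalizing p with
  | zero => exact ⟨0, by simpa using hp⟩
  | succ n ih =>
    set Q := shiftedJacobiPoly 1 1 n with hQ
    have hQn : Q.coeff n ≠ 0 := by
      rw [hQ, coeff_shiftedJacobiPoly_one_one_self]
      exact Nat.cast_ne_zero.mpr (Nat.choose_pos (by omega)).ne'
    obtain ⟨c, hc⟩ := ih (p - (p.coeff n / Q.coeff n) • Q) (by
      rw [degree_lt_iff_coeff_zero] at hp ⊢
      intro k hk
      rw [coeff_sub, coeff_smul, smul_eq_mul]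
      rcases hk.eq_or_lt with rfl | hk
      · rw [div_mul_cancel₀ _ hQn, sub_self]
      · rw [hp k hk, coeff_eq_zero_of_natDegree_lt
          ((natDegree_shiftedJacobiPoly_le 1 1 n).trans_lt hk), mul_zero, sub_zero])
    refine ⟨fun i => if i = n then p.coeff n / Q.coeff n else c i, ?_⟩
    simp only
    rw [sum_range_succ, if_pos rfl, ← hQ, eq_comm, ← eq_sub_iff_add_eq, hc]
    refine sum_congr rfl fun i hi => ?_
    rw [if_neg (mem_range.mp hi).ne]

theorem unitIntegral_shiftedJacobiPoly_of_ne {i m : ℕ} (h : i ≠ m) :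
    unitIntegral (X * (1 - X) * shiftedJacobiPoly 1 1 i * shiftedJacobiPoly 1 1 m) = 0 := by
  rcases h.lt_or_gt with h | h
  · rw [mul_right_comm]
    exact unitIntegral_shiftedJacobiPoly_mul_eq_zero
      ((natDegree_shiftedJacobiPoly_le _ _ _).trans_lt h)
  · exact unitIntegral_shiftedJacobiPoly_mul_eq_zero
      ((natDegree_shiftedJacobiPoly_le _ _ _).trans_lt h)

/-- The Fourier–Jacobi expansion of a polynomial. -/
theorem eq_sum_unitIntegral_smul (n : ℕ) (p : ℝ[X]) (hp : p.degree < n) :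
    p = ∑ m ∈ range n, ((2 * m + 3) * (m + 2) / (m + 1) *
      unitIntegral (X * (1 - X) * p * shiftedJacobiPoly 1 1 m)) • shiftedJacobiPoly 1 1 m := by
  obtain ⟨c, hc⟩ := exists_eq_sum_shiftedJacobiPoly n p hp
  conv_lhs => rw [hc]
  refine sum_congr rfl fun m hm => ?_
  congr 1
  rw [hc, mul_sum, sum_mul, map_sum, sum_eq_single_of_mem m hm]
  · rw [mul_smul_comm, smul_mul_assoc, map_smul, unitIntegral_shiftedJacobiPoly_sq, smul_eq_mul]
    have : (m : ℝ) + 1 ≠ 0 := by positivity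
    field_simp
  · intro i _ hi
    rw [mul_smul_comm, smul_mul_assoc, map_smul, unitIntegral_shiftedJacobiPoly_of_ne hi, smul_zero]

/-! ### Location of the zeros. -/

theorem eval_jacobi_one_one (n : ℕ) (t : ℝ) :
    (jacobi 1 1 n).eval t = 1 / 2 ^ n * ∑ k ∈ range (n + 1),
      ((n + 1).choose (n - k) * (n + 1).choose k : ℝ) * (t - 1) ^ k * (t + 1) ^ (n - k) := by
  have h : ∀ k : ℕ, Ring.choose ((n : ℝ) + 1) k = (n + 1).choose k := fun k =>
    cast_choose_eq _ _ _ (by push_cast; ring)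
  simp only [jacobi, h]
  simp [eval_finsetSum]

theorem eval_jacobi_one_one_pos (n : ℕ) {t : ℝ} (ht : 1 ≤ t) : 0 < (jacobi 1 1 n).eval t := by
  rw [eval_jacobi_one_one]
  refine mul_pos (by positivity) (sum_pos' (fun k _ => ?_) ⟨0, by simp, ?_⟩)
  · exact mul_nonneg (mul_nonneg (by positivity) (pow_nonneg (by linarith) _))
      (pow_nonneg (by linarith) _)
  · have : 0 < (n + 1).choose (n - 0) := Nat.choose_pos (by omega)
    have : 0 < (n + 1).choose 0 := Nat.choose_pos (by omega)
    have : 0 < t + 1 := by linarith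
    positivity

theorem eval_neg_jacobi_one_one (n : ℕ) (t : ℝ) :
    (jacobi 1 1 n).eval (-t) = (-1) ^ n * (jacobi 1 1 n).eval t := by
  rw [eval_jacobi_one_one, eval_jacobi_one_one, ← sum_range_reflect, mul_left_comm]
  congr 1
  rw [mul_sum]
  refine sum_congr rfl fun k hk => ?_
  obtain ⟨i, rfl⟩ := Nat.exists_eq_add_of_le (Nat.lt_succ_iff.mp (mem_range.mp hk))
  have e1 : k + i + 1 - 1 - k = i := by omega
  have e2 : k + i - i = k := by omega
  have e3 : k + i - k = i := by omega
  have h1 : -t - 1 = -1 * (t + 1) := by ring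
  have h2 : -t + 1 = -1 * (t - 1) := by ring
  rw [e1, e2, e3, h1, h2, mul_pow, mul_pow, pow_add]
  ring

/-- For `t ≥ 1` the defining sum has nonnegative terms and a positive one at `k = 0`; parity handles
`t ≤ -1`. -/
theorem mem_Ioo_of_eval_jacobi_one_one_eq_zero {n : ℕ} {t : ℝ}
    (h : (jacobi 1 1 n).eval t = 0) : t ∈ Set.Ioo (-1 : ℝ) 1 := by
  constructor
  · by_contra! ht
    have := eval_jacobi_one_one_pos n (t := -t) (by linarith)
    rw [eval_neg_jacobi_one_one, h, mul_zero] at this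
    exact this.false
  · by_contra! ht
    exact (eval_jacobi_one_one_pos n ht).ne' h

/-! ### Gauss quadrature and the expansion of the Lagrange basis. -/

theorem nodal_dvd_of_eval_eq_zero {n : ℕ} {v : Fin n → ℝ} (hv : Function.Injective v) {p : ℝ[X]}
    (hp : ∀ i, p.eval (v i) = 0) : Lagrange.nodal univ v ∣ p :=
  prod_dvd_of_coprime (fun _ _ _ _ hij => pairwise_coprime_X_sub_C hv hij)
    fun i _ => dvd_iff_isRoot.mpr (hp i)

/-- Exactness of the Jacobi–Gauss quadrature rule, tested on products with a Lagrange basis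
polynomial. -/
theorem unitIntegral_basis_mul {n : ℕ} {v : Fin n → ℝ} (hv : Function.Injective v)
    (h0 : shiftedJacobiPoly 1 1 n ≠ 0) (hz : ∀ i, (shiftedJacobiPoly 1 1 n).eval (v i) = 0)
    (j : Fin n) {q : ℝ[X]} (hq : q.natDegree < n) :
    unitIntegral (X * (1 - X) * Lagrange.basis univ v j * q) =
      q.eval (v j) * unitIntegral (X * (1 - X) * Lagrange.basis univ v j) := by
  set L := Lagrange.basis univ v j
  have hLd : L.natDegree = n - 1 := by
    rw [Lagrange.natDegree_basis hv.injOn (mem_univ j), card_univ, Fintype.card_fin]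
  have hnd : (Lagrange.nodal univ v).natDegree = n := by
    rw [Lagrange.natDegree_nodal, card_univ, Fintype.card_fin]
  have hmonic : (Lagrange.nodal univ v).Monic := Lagrange.nodal_monic
  -- By degree, the Jacobi polynomial is a nonzero constant `d` times the nodal polynomial.
  obtain ⟨c, hc⟩ := nodal_dvd_of_eval_eq_zero hv hz
  have hc0 : c ≠ 0 := by rintro rfl; exact h0 (by rw [hc, mul_zero])
  have hcd : c.natDegree ≤ 0 := by
    have h1 := hmonic.natDegree_mul' hc0
    have h2 := natDegree_shiftedJacobiPoly_le 1 1 n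
    rw [← hc, hnd] at h1
    omega
  rw [eq_C_of_natDegree_le_zero hcd] at hc hc0
  set d := c.coeff 0
  have hd0 : d ≠ 0 := by rintro h; exact hc0 (by rw [h, C_0])
  -- This difference vanishes at every node. Its quotient `s` has degree below `n`, so orthogonality
  -- annihilates its integral.
  obtain ⟨s, hs⟩ : Lagrange.nodal univ v ∣ L * q - C (q.eval (v j)) * L := by
    refine nodal_dvd_of_eval_eq_zero hv fun i => ?_
    rw [eval_sub, eval_mul, eval_mul, eval_C]
    rcases eq_or_ne j i with rfl | hij
    · ring
    · rw [Lagrange.eval_basis_of_ne hij (mem_univ i)]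
      ring
  have hsd : s.natDegree < n := by
    rcases eq_or_ne s 0 with rfl | hs0
    · rw [natDegree_zero]; exact j.pos
    · have h1 := hmonic.natDegree_mul' hs0
      have h2 : (L * q - C (q.eval (v j)) * L).natDegree ≤ (n - 1) + q.natDegree := by
        have h3 : (L * q).natDegree ≤ (n - 1) + q.natDegree := natDegree_mul_le_of_le hLd.le le_rfl
        have h4 : (C (q.eval (v j)) * L).natDegree ≤ (n - 1) + q.natDegree :=
          (natDegree_C_mul_le _ _).trans (hLd.le.trans (Nat.le_add_right _ _))
        exact (natDegree_sub_le _ _).trans (max_le h3 h4)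
      rw [← hs, hnd] at h1
      have := j.pos
      omega
  have ho := unitIntegral_shiftedJacobiPoly_mul_eq_zero hsd
  have he : X * (1 - X) * L * q =
      q.eval (v j) • (X * (1 - X) * L) + d⁻¹ • (X * (1 - X) * shiftedJacobiPoly 1 1 n * s) := by
    have hdd : C d⁻¹ * C d = (1 : ℝ[X]) := by rw [← C_mul, inv_mul_cancel₀ hd0, C_1]
    rw [hc, smul_eq_C_mul, smul_eq_C_mul]
    linear_combination (X * (1 - X) : ℝ[X]) * hs -
      (X * (1 - X) * Lagrange.nodal univ v * s) * hdd
  rw [he, map_add, map_smul, map_smul, ho, smul_zero, add_zero, smul_eq_mul]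

theorem eval_basis_shiftedNode {n : ℕ} (ξ : Fin n → ℝ) (j : Fin n) (x : ℝ) :
    (Lagrange.basis univ (shiftedNode ξ) j).eval x =
      (Lagrange.basis univ ξ j).eval (2 * x - 1) := by
  simp only [Lagrange.basis, eval_prod]
  refine prod_congr rfl fun k _ => ?_
  have h : shiftedNode ξ j - shiftedNode ξ k = (ξ j - ξ k) / 2 := by
    simp only [shiftedNode]; ring
  have h' : x - shiftedNode ξ k = (2 * x - 1 - ξ k) / 2 := by
    simp only [shiftedNode]; ring
  simp only [Lagrange.basisDivisor, eval_mul, eval_C, eval_sub, eval_X, h, h']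
  rw [inv_div]
  ring

/-- Under `t = 2x - 1` the factor `8` is `2` from `dt` times `4` from `1 - t² = 4x(1-x)`. -/
theorem gaussWeight_one_one_eq {n : ℕ} (ξ : Fin n → ℝ) (j : Fin n) :
    gaussWeight 1 1 ξ j =
      8 * unitIntegral (X * (1 - X) * Lagrange.basis univ (shiftedNode ξ) j) := by
  have h := intervalIntegral.integral_comp_mul_sub (a := 0) (b := 1)
    (fun t : ℝ => (1 - t) ^ (1 : ℝ) * (1 + t) ^ (1 : ℝ) * (Lagrange.basis univ ξ j).eval t)
    (two_ne_zero) 1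
  have e : ∀ x : ℝ, (1 - (2 * x - 1)) ^ (1 : ℝ) * (1 + (2 * x - 1)) ^ (1 : ℝ) *
      (Lagrange.basis univ ξ j).eval (2 * x - 1) =
      4 * (X * (1 - X) * Lagrange.basis univ (shiftedNode ξ) j).eval x := by
    intro x
    simp only [Real.rpow_one, eval_mul, eval_sub, eval_X, eval_one, eval_basis_shiftedNode]
    ring
  simp only [e] at h
  rw [intervalIntegral.integral_const_mul, ← unitIntegral_apply] at h
  norm_num at h
  rw [gaussWeight]
  simp only [Real.rpow_one]
  linarith

theorem basis_eq_sum_shiftedJacobiPoly {n : ℕ} {ξ : Fin n → ℝ} (hξ : IsJacobiGaussNodes 1 1 n ξ)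
    (j : Fin n) :
    Lagrange.basis univ (shiftedNode ξ) j = ∑ m ∈ range n,
      ((2 * m + 3) * (m + 2) / (8 * (m + 1)) * gaussWeight 1 1 ξ j *
        shiftedJacobi 1 1 m (shiftedNode ξ j)) • shiftedJacobiPoly 1 1 m := by
  have hv : Function.Injective (shiftedNode ξ) := fun a b hab => hξ.1 (by
    simp only [shiftedNode] at hab; linarith)
  have h0 : shiftedJacobiPoly 1 1 n ≠ 0 := fun h => by
    have h1 := eval_jacobi_one_one_pos n le_rfl
    have h2 := eval_shiftedJacobiPoly 1 1 n 1
    rw [h, eval_zero, shiftedJacobi] at h2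
    norm_num at h2
    linarith
  have hz : ∀ i, (shiftedJacobiPoly 1 1 n).eval (shiftedNode ξ i) = 0 := fun i => by
    have h1 : ξ i ∈ {t : ℝ | (jacobi 1 1 n).eval t = 0} := hξ.2 ▸ Set.mem_range_self i
    have e : 2 * shiftedNode ξ i - 1 = ξ i := by simp only [shiftedNode]; ring
    rw [eval_shiftedJacobiPoly, shiftedJacobi, e]
    exact h1
  have hdeg : (Lagrange.basis univ (shiftedNode ξ) j).degree < n := by
    rw [Lagrange.degree_basis hv.injOn (mem_univ j), card_univ, Fintype.card_fin]
    exact_mod_cast Nat.sub_lt j.pos one_pos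
  conv_lhs => rw [eq_sum_unitIntegral_smul n _ hdeg]
  refine sum_congr rfl fun m hm => ?_
  rw [unitIntegral_basis_mul hv h0 hz j
    ((natDegree_shiftedJacobiPoly_le 1 1 m).trans_lt (mem_range.mp hm)),
    gaussWeight_one_one_eq, eval_shiftedJacobiPoly]
  congr 1
  have : (m : ℝ) + 1 ≠ 0 := by positivity
  field_simp

/-- The expansion of the modified Lagrange basis, as an identity of evaluations of polynomials. -/
theorem modLagrange_eq_eval {n : ℕ} {ξ : Fin n → ℝ} (hξ : IsJacobiGaussNodes 1 1 n ξ) (j : Fin n) :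
    modLagrange ξ j = fun x => (∑ k ∈ Icc 1 n,
      lam ξ j k • (X * (1 - X) * shiftedJacobiPoly 1 1 (k - 1)) : ℝ[X]).eval x := by
  funext x
  rw [modLagrange, basis_eq_sum_shiftedJacobiPoly hξ j, eval_finsetSum, eval_finsetSum,
    ← Ico_add_one_right_eq_Icc, sum_Ico_eq_sum_range, Nat.add_sub_cancel, mul_sum]
  refine sum_congr rfl fun m _ => ?_
  rw [Nat.add_sub_cancel_left, eval_smul, eval_smul, lam, Nat.add_sub_cancel_left]
  simp only [smul_eq_mul, eval_mul, eval_sub, eval_X, eval_one]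
  push_cast
  have : (2 * (1 + (m : ℝ)) + 1) = 2 * m + 3 := by ring
  rw [this, add_comm (1 : ℝ) m]
  ring

end FracDiff

end

theorem mainTheorem1 (β : ℝ) (hβ0 : 0 < β) (hβ1 : β < 1) (n : ℕ) (ξ : Fin n → ℝ)
    (hξ : FracDiff.IsJacobiGaussNodes 1 1 n ξ) :
    (∀ (j : Fin n) (x : ℝ), FracDiff.modLagrange ξ j x =
      ∑ k ∈ Finset.Icc 1 n,
        FracDiff.lam ξ j k * (x * (1 - x) * FracDiff.shiftedJacobi 1 1 (k - 1) x)) ∧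
    ∀ i j : Fin n,
      FracDiff.LeftRLDifferentiableAt (2 - β) (FracDiff.modLagrange ξ j)
        (FracDiff.shiftedNode ξ i) ∧
      FracDiff.leftFracDiffMatrix β ξ i j =
        ∑ k ∈ Finset.Icc 1 n,
          FracDiff.lam ξ j k * FracDiff.zeta β k (FracDiff.shiftedNode ξ i) := by
  refine ⟨fun j x => ?_, fun i j => ?_⟩
  · rw [FracDiff.modLagrange_eq_eval hξ j]
    simp [Polynomial.eval_finsetSum, FracDiff.eval_shiftedJacobiPoly]
  · have hi : ξ i ∈ {t : ℝ | (FracDiff.jacobi 1 1 n).eval t = 0} := hξ.2 ▸ Set.mem_range_self i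
    have hx : 0 < FracDiff.shiftedNode ξ i := by
      have := (FracDiff.mem_Ioo_of_eval_jacobi_one_one_eq_zero hi).1
      simp only [FracDiff.shiftedNode]
      linarith
    have h := FracDiff.leftRL_eval hβ0 hβ1 (∑ k ∈ Finset.Icc 1 n, FracDiff.lam ξ j k •
      (Polynomial.X * (1 - Polynomial.X) * FracDiff.shiftedJacobiPoly 1 1 (k - 1))) hx
    rw [← FracDiff.modLagrange_eq_eval hξ j] at h
    refine ⟨h.1, h.2.trans ?_⟩
    rw [map_sum]
    refine Finset.sum_congr rfl fun k hk => ?_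
    rw [map_smul, smul_eq_mul,
      FracDiff.rlPoly_X_mul_one_sub_X_mul hβ0 hx k (Finset.mem_Icc.mp hk).1]
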